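/- **Setting.** Let $(E,\mathcal E)$ be a measurable space with a non-zero finite measure $du$, let $\kappa_l:E\to(0,\infty)$ ($l=0,1,2,\dots$) and $\kappa_\infty:E\to[0,\infty)$ be measurable and integrable with $\int_E\kappa_\infty(u)\,du>0$, and put $Z_l=\int_E\kappa_l(u)\,du$, $\eta_l(du)=\kappa_l(u)\,du/Z_l$ and $G_l=\kappa_{l+1}/\kappa_l$. For $l\ge1$ let $M_l$ be a Markov kernel on $E$ with $\eta_lM_l=\eta_l$. Let $h_0>h_1>\cdots>0$ be accuracy parameters with $h_l\to0$, decaying geometrically: there are $m>1$ and $0<c\le c'$ with $c\,m^{-l}\le h_l\le c'm^{-l}$ for all $l\ge 0$. Let $\gamma_0=\eta_0$ and $\gamma_{l+1}(dv)=\int_E\gamma_l(du)\,G_l(u)\,M_{l+1}(u,dv)$, and let $\gamma_\infty(1)=Z_\infty/Z_0$. Let ${\rm C}(G_l)\ge0$ denote the cost of one evaluation of $G_l$. Given particle numbers $N_0\ge N_1\ge\cdots\ge 1$, the multilevel SMC sampler draws $U_0^{1},\dots,U_0^{N_0}$ i.i.d. from $\eta_0$ and then, for $l\ge0$, given the particles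 up to level $l$, draws $U_{l+1}^1,\dots,U_{l+1}^{N_{l+1}}$ i.i.d. from $\sum_iG_l(U_l^i)M_{l+1}(U_l^i,\cdot)/\sum_iG_l(U_l^i)$. The standard estimator of the normalizing constant is $$\gamma_L^{N_{0:L-1}}(1)=\prod_{p=0}^{L-1}\frac1{N_p}\sum_{i=1}^{N_p}G_p(U_p^i),$$ and its cost is ${\rm COST}=\sum_{p=0}^{L-1}N_p\,{\rm C}(G_p)$. **Assumptions.** Let $\alpha,\beta,\zeta>0$. * (A1) There are $0<\underline C<\overline C<\infty$ with $\underline C\le\kappa_l(u)\le\overline C$ for all $0\le l<\infty$, $u\in E$. * (A2) There is $\rho\in(0,1)$ with $M_l(u,A)\ge\rho\,M_l(v,A)$ for all $l\ge1$, $u,v\in E$, $A\in\mathcal E$. * (A3)(i) There is $C>0$ such that for all $p\ge1$, $\left|\gamma_p(1)/\gamma_\infty(1)-1\right|\le Ch_p^\alpha$ and ${\rm C}(G_{p-1})\le Ch_p^{-\zeta}$. * (A3)(ii) There is $C>0$ such that for all $p\ge1$, $\left\|G_{p-1}/\eta_{p-1}(G_{p-1})-1\right\|_\infty^2\le Ch_p^\beta$.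 **Claim.** Suppose moreover that $2\alpha\ge\max\{\beta,\zeta\}$. Then for every $\varepsilon_0\in(0,1)$ there is a constant $C>0$ such that for every $\varepsilon\in(0,\varepsilon_0]$ there exist $L\ge1$ and $N_0\ge N_1\ge\cdots\ge1$ for which the square of the error is integrable, $$\frac1{\gamma_\infty(1)^2}\,\mathbb E\Big[\big(\gamma_L^{N_{0:L-1}}(1)-\gamma_\infty(1)\big)^2\Big]\le C\varepsilon^2,$$ and $${\rm COST}\le C\begin{cases}\varepsilon^{-2}|\log\varepsilon|,&\text{if }\beta>\zeta,\\ \varepsilon^{-2}|\log\varepsilon|^3,&\text{if }\beta=\zeta,\\ \varepsilon^{-\left(2+\frac{\zeta-\beta}{\alpha}\right)}|\log\varepsilon|,&\text{if }\beta<\zeta.\end{cases}$$ -/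

import Mathlib

open MeasureTheory ProbabilityTheory Filter Topology
open scoped ENNReal

/-- The supremum norm `‖f‖_∞ = sup_u |f u|` (used for bounded functions only). -/
noncomputable def supNorm {E : Type*} (f : E → ℝ) : ℝ := ⨆ u, |f u|

/-- The setting of the multilevel sequential Monte Carlo sampler.
* `μ` is the dominating finite measure `du`;
* `κ l` are the unnormalised densities at level `l < ∞`, and `κInf` is the one at level `∞`;
* `M l` (for `l ≥ 1`) are the MCMC kernels, `M l` leaving `η_l = κ_l du / Z_l` invariant
  (`M 0` is never used);
* `h l` are the accuracy parameters;
* `evalCost l` is the cost of one evaluation of `G_l = κ_{l+1} / κ_l`. -/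
structure MLSMCModel (E : Type*) [MeasurableSpace E] where
  μ : Measure E
  μ_finite : IsFiniteMeasure μ
  μ_ne_zero : μ ≠ 0
  κ : ℕ → E → ℝ
  κ_measurable : ∀ l, Measurable (κ l)
  κ_pos : ∀ l u, 0 < κ l u
  κ_integrable : ∀ l, Integrable (κ l) μ
  κInf : E → ℝ
  κInf_measurable : Measurable κInf
  κInf_nonneg : ∀ u, 0 ≤ κInf u
  κInf_integrable : Integrable κInf μ
  κInf_integral_pos : 0 < ∫ u, κInf u ∂μ
  M : ℕ → Kernel E E
  M_markov : ∀ l, IsMarkovKernel (M l)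
  M_invariant : ∀ l, 1 ≤ l → Kernel.Invariant (M l)
    (μ.withDensity fun u => ENNReal.ofReal (κ l u / ∫ v, κ l v ∂μ))
  h : ℕ → ℝ
  h_pos : ∀ l, 0 < h l
  h_strictAnti : StrictAnti h
  h_tendsto : Tendsto h atTop (𝓝 0)
  evalCost : ℕ → ℝ
  evalCost_nonneg : ∀ l, 0 ≤ evalCost l

namespace MLSMCModel

variable {E : Type*} [MeasurableSpace E] (P : MLSMCModel E)

/-- The normalising constant `Z_l`. -/
noncomputable def Z (l : ℕ) : ℝ := ∫ u, P.κ l u ∂P.μ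

/-- The normalising constant `Z_∞`. -/
noncomputable def ZInf : ℝ := ∫ u, P.κInf u ∂P.μ

/-- The target `η_l(du) = κ_l(u) du / Z_l`. -/
noncomputable def η (l : ℕ) : Measure E :=
  P.μ.withDensity fun u => ENNReal.ofReal (P.κ l u / P.Z l)

/-- The incremental weight `G_l = κ_{l+1} / κ_l`. -/
noncomputable def G (l : ℕ) (u : E) : ℝ := P.κ (l + 1) u / P.κ l u

/-- The Feynman–Kac measures: `γ_0 = η_0` and
`γ_{l+1}(dv) = ∫ γ_l(du) G_l(u) M_{l+1}(u, dv)`. -/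
noncomputable def γ : ℕ → Measure E
  | 0 => P.η 0
  | l + 1 => ((γ l).withDensity fun u => ENNReal.ofReal (P.G l u)).bind (P.M (l + 1))

/-- `γ_l(1)`, the total mass of `γ_l`. -/
noncomputable def γOne (l : ℕ) : ℝ := (P.γ l).real Set.univ

/-- `γ_∞(1) = Z_∞ / Z_0`. -/
noncomputable def γInfOne : ℝ := P.ZInf / P.Z 0

/-! ### The particle system -/

theorem G_pos (l : ℕ) (u : E) : 0 < P.G l u := div_pos (P.κ_pos _ _) (P.κ_pos _ _)

theorem measurable_G (l : ℕ) : Measurable (P.G l) :=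
  (P.κ_measurable _).div (P.κ_measurable _)

theorem Z_pos (l : ℕ) : 0 < P.Z l := by
  unfold Z
  rw [integral_pos_iff_support_of_nonneg (fun u => (P.κ_pos l u).le) (P.κ_integrable l)]
  have : Function.support (P.κ l) = Set.univ :=
    Set.eq_univ_of_forall fun u => (P.κ_pos l u).ne'
  rw [this, Measure.measure_univ_pos]
  exact P.μ_ne_zero

instance isProbabilityMeasure_η (l : ℕ) : IsProbabilityMeasure (P.η l) := by
  refine ⟨?_⟩
  unfold η
  rw [withDensity_apply _ MeasurableSet.univ, Measure.restrict_univ,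
    ← ofReal_integral_eq_lintegral_ofReal ((P.κ_integrable l).div_const _)
      (Eventually.of_forall fun u => (div_pos (P.κ_pos l u) (P.Z_pos l)).le),
    integral_div]
  change ENNReal.ofReal (P.Z l / P.Z l) = 1
  rw [div_self (P.Z_pos l).ne', ENNReal.ofReal_one]

/-- The conditional law of one particle at level `l + 1` given the `n` particles `u` at level `l`
(selection proportionally to `G_l`, then mutation with `M_{l+1}`):
`∑ i, G_l(u^i) M_{l+1}(u^i, ·) / ∑ i, G_l(u^i)`. -/
noncomputable def selMutMeasure (l : ℕ) {n : ℕ+} (u : Fin n → E) : Measure E :=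
  (∑ i, ENNReal.ofReal (P.G l (u i)))⁻¹ •
    ∑ i, ENNReal.ofReal (P.G l (u i)) • P.M (l + 1) (u i)

instance isProbabilityMeasure_selMutMeasure (l : ℕ) {n : ℕ+} (u : Fin n → E) :
    IsProbabilityMeasure (P.selMutMeasure l u) := by
  have := P.M_markov (l + 1)
  refine ⟨?_⟩
  simp only [selMutMeasure, Measure.smul_apply, Measure.finsetSum_apply, measure_univ, smul_eq_mul,
    mul_one]
  refine ENNReal.inv_mul_cancel ?_ ?_
  · rw [Ne, Finset.sum_eq_zero_iff]
    intro h0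
    have := h0 ⟨0, n.pos⟩ (Finset.mem_univ _)
    rw [ENNReal.ofReal_eq_zero] at this
    exact absurd this (not_le.mpr (P.G_pos _ _))
  · exact ENNReal.sum_ne_top.mpr fun _ _ => ENNReal.ofReal_ne_top

theorem measurable_selMutMeasure (l : ℕ) (n : ℕ+) :
    Measurable fun u : Fin n → E => P.selMutMeasure l u := by
  refine Measure.measurable_of_measurable_coe _ fun s hs => ?_
  simp only [selMutMeasure, Measure.smul_apply, Measure.finsetSum_apply, smul_eq_mul]
  have hG : ∀ i, Measurable fun u : Fin n → E => ENNReal.ofReal (P.G l (u i)) := fun i =>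
    ((P.measurable_G l).comp (measurable_pi_apply i)).ennreal_ofReal
  refine (Finset.measurable_sum _ fun i _ => hG i).inv.mul
    (Finset.measurable_sum _ fun i _ => (hG i).mul ?_)
  exact ((P.M (l + 1)).measurable_coe hs).comp (measurable_pi_apply i)

/-- The transition from the `n` particles at level `l` to the `m` particles at level `l + 1`:
given the former, the latter are i.i.d. with law `selMutMeasure`. -/
noncomputable def popKernel (l : ℕ) (n m : ℕ+) : Kernel (Fin n → E) (Fin m → E) where
  toFun u := Measure.pi fun _ => P.selMutMeasure l u
  measurable' := by
    refine Measurable.measure_of_isPiSystem_of_isProbabilityMeasure generateFrom_pi.symm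
      isPiSystem_pi ?_
    rintro _ ⟨s, hs, rfl⟩
    simp only [Measure.pi_pi]
    exact Finset.measurable_prod _ fun i _ =>
      (Measure.measurable_coe (hs i (Set.mem_univ i))).comp (P.measurable_selMutMeasure l n)

instance isMarkovKernel_popKernel (l : ℕ) (n m : ℕ+) : IsMarkovKernel (P.popKernel l n m) :=
  ⟨fun u => by change IsProbabilityMeasure (Measure.pi fun _ => P.selMutMeasure l u); infer_instance⟩

/-- The law of the particle system `(U_l^{1:N_l})_{l ≥ 0}`, as the law of the (inhomogeneous)
Markov chain of populations started from `N_0` i.i.d. samples of `η_0`. -/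
noncomputable def smcLaw (N : ℕ → ℕ+) : Measure (∀ l, Fin (N l) → E) :=
  Kernel.trajMeasure (X := fun l => Fin (N l) → E) (Measure.pi fun _ => P.η 0) fun l =>
    (P.popKernel l (N l) (N (l + 1))).comap (fun u => u ⟨l, Finset.mem_Iic.mpr le_rfl⟩)
      (measurable_pi_apply _)

/-- The standard estimator
`γ_L^{N_{0:L-1}}(1) = ∏_{p<L} η_p^{N_p}(G_p)` with `η_p^{N_p}(G_p) = N_p⁻¹ ∑ i, G_p(U_p^i)`. -/
noncomputable def estimator (N : ℕ → ℕ+) (L : ℕ) (U : ∀ l, Fin (N l) → E) : ℝ :=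
  ∏ p ∈ Finset.range L, (∑ i, P.G p (U p i)) / (N p : ℝ)

/-- The cost of computing the standard estimator: `N_p` evaluations of `G_p` for each `p < L`. -/
noncomputable def cost (N : ℕ → ℕ+) (L : ℕ) : ℝ :=
  ∑ p ∈ Finset.range L, (N p : ℝ) * P.evalCost p

/-! ### Assumptions -/

/-- (A1): the densities are bounded above and below, uniformly in the level. -/
def UniformBounds : Prop :=
  ∃ c C : ℝ, 0 < c ∧ c < C ∧ ∀ l u, c ≤ P.κ l u ∧ P.κ l u ≤ C

/-- (A2): the uniform mixing condition for the MCMC kernels. -/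
def UniformMixing : Prop :=
  ∃ ρ : ℝ, 0 < ρ ∧ ρ < 1 ∧ ∀ l, 1 ≤ l → ∀ u v : E, ∀ A : Set E, MeasurableSet A →
    ENNReal.ofReal ρ * P.M l v A ≤ P.M l u A

/-- (A3)(i): the rates for the bias and for the cost. -/
def BiasCostRates (α ζ : ℝ) : Prop :=
  ∃ C : ℝ, 0 < C ∧ ∀ p : ℕ, 1 ≤ p →
    |P.γOne p / P.γInfOne - 1| ≤ C * P.h p ^ α ∧ P.evalCost (p - 1) ≤ C * P.h p ^ (-ζ)

/-- (A3)(ii): the rate for the relative fluctuation of the weights. -/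
def WeightRate (β : ℝ) : Prop :=
  ∃ C : ℝ, 0 < C ∧ ∀ p : ℕ, 1 ≤ p →
    supNorm (fun u => P.G (p - 1) u / (∫ v, P.G (p - 1) v ∂P.η (p - 1)) - 1) ^ 2
      ≤ C * P.h p ^ β

/-- The accuracy parameters decay geometrically, `h_l ≍ m^{-l}` for some `m > 1`. -/
def GeometricLevels : Prop :=
  ∃ m c C : ℝ, 1 < m ∧ 0 < c ∧ ∀ l : ℕ, c * (m ^ l)⁻¹ ≤ P.h l ∧ P.h l ≤ C * (m ^ l)⁻¹

end MLSMCModel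

/-- The cost rate as a function of the accuracy `ε`. -/
noncomputable def costRate (α β ζ ε : ℝ) : ℝ :=
  if ζ < β then ε ^ (-2 : ℝ) * |Real.log ε|
  else if β = ζ then ε ^ (-2 : ℝ) * |Real.log ε| ^ 3
  else ε ^ (-(2 + (ζ - β) / α)) * |Real.log ε|

/-!
Write `g_p = G_p / η_p(G_p)` for the normalised weights. Since `M_l` preserves `η_l`, one has
`γ_l = (Z_l / Z_0) η_l`, so that the estimator equals `γ_L(1) X_L` with
`X_L = ∏_{p < L} η_p^{N_p}(g_p)`, and its relative error splits into the bias
`γ_L(1) / γ_∞(1) - 1 = O(h_L^α)` and the fluctuation `X_L - 1`.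

Let `f_p` be the normalised Feynman–Kac semigroup from level `p` to level `L` applied to `1`
(`lookAhead`), that is `f_L = 1` and `f_p = g_p M_{p+1} f_{p+1}`. Then `X_p η_p^{N_p}(f_p)` is a
martingale with mean `1` which ends in `X_L`, and its increment at level `p`, given the previous
populations, is `X_p` times a centred empirical mean of `N_p` i.i.d. variables; its conditional
variance is at most `X_p ^ 2 ‖f_p - 1‖² / N_p`. With geometric levels, the weights satisfy
`|g_p - 1| ≤ D t^p` for `t = m^{-β/2} < 1` (`WeightRate.weightDecay`). Such deviations are summable,
hence the products of weights obey `X_p ≤ e^{D/(1-t)}` (`WeightDecay.normEstimator_le_exp`) and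
`‖f_p - 1‖ ≤ e^{D t^p/(1-t)} - 1 = O(t^p)` (`WeightDecay.abs_lookAhead_sub_one_le`) deterministically
and uniformly in `L`, without an appeal to the mixing of the kernels. Summing the increments gives
`E (X_L - 1)² = O(∑_{p < L} m^{-β p} / N_p)` (`WeightDecay.integral_normEstimator_sub_one_sq_le`).

It remains to balance this variance against the cost `∑_{p < L} N_p m^{ζ p}`, as in multilevel Monte
Carlo: `L` is chosen with `m^{-α L} ≈ ε` and `N_p` proportional to `ε⁻² m^{-(β+ζ)p/2}`
(`exists_antitone_particleNumbers`), and a geometric sum with ratio `m^{(ζ-β)/2}` produces the three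
regimes (`exists_sum_sq_le_costRate`).
-/

/-! ### Empirical means of independent samples -/

/-- The empirical mean `n⁻¹ ∑ i, φ (u i)` of `φ` over a population of `n` particles. -/
noncomputable def empMean {E : Type*} {n : ℕ+} (φ : E → ℝ) (u : Fin n → E) : ℝ :=
  (∑ i, φ (u i)) / (n : ℝ)

section empMean

variable {E : Type*} {n : ℕ+}

theorem abs_empMean_le {φ : E → ℝ} {K : ℝ} (hφ : ∀ x, |φ x| ≤ K) (u : Fin n → E) :
    |empMean φ u| ≤ K := by
  have hn : (0 : ℝ) < n := by exact_mod_cast n.pos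
  rw [empMean, abs_div, abs_of_pos hn, div_le_iff₀ hn]
  calc |∑ i, φ (u i)| ≤ ∑ i, |φ (u i)| := Finset.abs_sum_le_sum_abs _ _
    _ ≤ ∑ _i : Fin n, K := Finset.sum_le_sum fun i _ => hφ _
    _ = K * n := by simp [mul_comm]

theorem empMean_pos {φ : E → ℝ} (hφ : ∀ x, 0 < φ x) (u : Fin n → E) : 0 < empMean φ u := by
  have hn : (0 : ℝ) < n := by exact_mod_cast n.pos
  exact div_pos (Finset.sum_pos (fun i _ => hφ _) ⟨⟨0, n.pos⟩, Finset.mem_univ _⟩) hn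

theorem measurable_empMean [MeasurableSpace E] {φ : E → ℝ} (hφ : Measurable φ) :
    Measurable (empMean φ : (Fin n → E) → ℝ) :=
  (Finset.measurable_sum _ fun i _ => hφ.comp (measurable_pi_apply i)).div_const _

/-- For i.i.d. samples, the mean squared distance of `x * empMean φ` to `1` splits into the squared
bias and a variance of order `n⁻¹`. -/
theorem integral_sq_mul_empMean_sub_one_le [MeasurableSpace E] (ν : Measure E)
    [IsProbabilityMeasure ν] {φ : E → ℝ} (hφ : Measurable φ) {a : ℝ} (ha : ∀ x, |φ x - 1| ≤ a)
    (x : ℝ) :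
    ∫ u, (x * empMean φ u - 1) ^ 2 ∂(Measure.pi fun _ : Fin n => ν)
      ≤ (x * ∫ v, φ v ∂ν - 1) ^ 2 + x ^ 2 * (a ^ 2 / n) := by
  have hn : (0 : ℝ) < n := by exact_mod_cast n.pos
  have hb : ∀ v, |φ v| ≤ a + 1 := fun v => by
    have := abs_add_le (φ v - 1) 1
    rw [sub_add_cancel, abs_one] at this
    linarith [ha v]
  have hmem : MemLp φ 2 ν :=
    MemLp.of_bound hφ.aestronglyMeasurable (a + 1) (Eventually.of_forall hb)
  have hint : Integrable φ ν := hmem.integrable (by norm_num)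
  have hvar1 : Var[φ; ν] ≤ a ^ 2 := by
    have h1 : Var[φ; ν] = Var[fun v => φ v - 1; ν] := by
      have := variance_add_const hφ.aestronglyMeasurable (μ := ν) (-1)
      simpa [sub_eq_add_neg] using this.symm
    rw [h1]
    refine (variance_le_expectation_sq (hφ.sub_const 1).aestronglyMeasurable).trans ?_
    calc ∫ v, (φ v - 1) ^ 2 ∂ν ≤ ∫ _, a ^ 2 ∂ν := by
          refine integral_mono_of_nonneg (Eventually.of_forall fun v => sq_nonneg _)
            (integrable_const _) (Eventually.of_forall fun v => ?_)
          exact sq_le_sq.mpr ((ha v).trans (le_abs_self a))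
      _ = a ^ 2 := by simp
  set Pn := Measure.pi fun _ : Fin n => ν with hPn
  have hm : Measurable (empMean φ : (Fin n → E) → ℝ) := measurable_empMean hφ
  have hmL : MemLp (empMean φ : (Fin n → E) → ℝ) 2 Pn :=
    MemLp.of_bound hm.aestronglyMeasurable (a + 1) (Eventually.of_forall (abs_empMean_le hb))
  have hmean : ∫ u, empMean φ u ∂Pn = ∫ v, φ v ∂ν := by
    simp only [empMean]
    rw [integral_div, integral_finsetSum]
    · have : ∀ i : Fin n, ∫ u, φ (u i) ∂Pn = ∫ v, φ v ∂ν := fun i => by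
        have hmp := measurePreserving_eval (fun _ : Fin n => ν) i
        rw [← hmp.map_eq, integral_map hmp.measurable.aemeasurable hφ.aestronglyMeasurable]
      simp [this]
    · intro i _
      exact (measurePreserving_eval (fun _ : Fin n => ν) i).integrable_comp_of_integrable hint
  have hvar : Var[(empMean φ : (Fin n → E) → ℝ); Pn] = Var[φ; ν] / n := by
    have h1 : (empMean φ : (Fin n → E) → ℝ)
        = fun u => (n : ℝ)⁻¹ * (∑ i : Fin n, fun u : Fin n → E => φ (u i)) u := by
      ext u; simp [empMean, div_eq_inv_mul]
    rw [h1, variance_const_mul, hPn, variance_sum_pi (fun _ => hmem)]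
    simp
    field_simp
  have hlin : ∫ u, (x * empMean φ u - 1) ^ 2 ∂Pn
      = x ^ 2 * ∫ u, (empMean φ u) ^ 2 ∂Pn - 2 * x * ∫ u, empMean φ u ∂Pn + 1 := by
    have h2 : Integrable (fun u : Fin n → E => (empMean φ u) ^ 2) Pn := hmL.integrable_sq
    have h1 : Integrable (fun u : Fin n → E => empMean φ u) Pn := hmL.integrable (by norm_num)
    have : ∀ u : Fin n → E, (x * empMean φ u - 1) ^ 2
        = x ^ 2 * (empMean φ u) ^ 2 - 2 * x * empMean φ u + 1 := fun u => by ring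
    simp_rw [this]
    rw [integral_add (f := fun u => x ^ 2 * empMean φ u ^ 2 - 2 * x * empMean φ u)
      ((h2.const_mul _).sub (h1.const_mul _)) (integrable_const _),
      integral_sub (h2.const_mul _) (h1.const_mul _), integral_const_mul, integral_const_mul]
    simp
  have hsq : ∫ u, (empMean φ u) ^ 2 ∂Pn = Var[φ; ν] / n + (∫ v, φ v ∂ν) ^ 2 := by
    have := variance_eq_sub hmL
    rw [hvar, hmean] at this
    simp only [Pi.pow_apply] at this
    linarith
  rw [hlin, hsq, hmean]
  have := mul_le_mul_of_nonneg_left (div_le_div_of_nonneg_right hvar1 hn.le) (sq_nonneg x)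
  linarith

end empMean

namespace MLSMCModel

variable {E : Type*} [MeasurableSpace E] (P : MLSMCModel E)

/-! ### Normalised weights and the Feynman–Kac flow -/

/-- The normalised weight `g_l = G_l / η_l(G_l)`, with `η_l(G_l) = Z_{l+1} / Z_l` substituted. -/
noncomputable def normWeight (l : ℕ) (u : E) : ℝ := P.G l u / (P.Z (l + 1) / P.Z l)

theorem normWeight_pos (l : ℕ) (u : E) : 0 < P.normWeight l u :=
  div_pos (P.G_pos l u) (div_pos (P.Z_pos _) (P.Z_pos _))

theorem measurable_normWeight (l : ℕ) : Measurable (P.normWeight l) :=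
  (P.measurable_G l).div_const _

theorem G_eq_mul_normWeight (l : ℕ) (u : E) :
    P.G l u = P.Z (l + 1) / P.Z l * P.normWeight l u := by
  have := (div_pos (P.Z_pos (l + 1)) (P.Z_pos l)).ne'
  rw [normWeight, mul_div_cancel₀ _ this]

theorem withDensity_normWeight_η (l : ℕ) :
    (P.η l).withDensity (fun u => ENNReal.ofReal (P.normWeight l u)) = P.η (l + 1) := by
  unfold η
  rw [← withDensity_mul _ ((P.κ_measurable l).div_const _).ennreal_ofReal
    (P.measurable_normWeight l).ennreal_ofReal]
  congr 1
  ext u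
  rw [Pi.mul_apply, ← ENNReal.ofReal_mul (div_pos (P.κ_pos l u) (P.Z_pos l)).le]
  congr 1
  have h1 := (P.Z_pos l).ne'
  have h2 := (P.Z_pos (l + 1)).ne'
  have h3 := (P.κ_pos l u).ne'
  rw [normWeight, G]
  field_simp

theorem η_bind (l : ℕ) : (P.η (l + 1)).bind (P.M (l + 1)) = P.η (l + 1) :=
  P.M_invariant (l + 1) (Nat.le_add_left _ _)

/-- Each `γ_l` is the multiple `(Z_l / Z_0) η_l` of the target. -/
theorem γ_eq_smul_η (l : ℕ) : P.γ l = ENNReal.ofReal (P.Z l / P.Z 0) • P.η l := by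
  induction l with
  | zero => simp [γ, (P.Z_pos 0).ne']
  | succ l ih =>
    have h1 : (fun u => ENNReal.ofReal (P.G l u))
        = ENNReal.ofReal (P.Z (l + 1) / P.Z l) •
          fun u => ENNReal.ofReal (P.normWeight l u) := by
      ext u
      rw [Pi.smul_apply, smul_eq_mul,
        ← ENNReal.ofReal_mul (div_pos (P.Z_pos _) (P.Z_pos _)).le, ← G_eq_mul_normWeight]
    rw [γ, ih, h1, withDensity_smul_measure,
      withDensity_smul _ (P.measurable_normWeight l).ennreal_ofReal, withDensity_normWeight_η,
      smul_smul, Measure.bind_smul, η_bind,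
      ← ENNReal.ofReal_mul (div_pos (P.Z_pos _) (P.Z_pos _)).le]
    congr 2
    have h1 := (P.Z_pos l).ne'
    have h2 := (P.Z_pos 0).ne'
    field_simp

theorem γOne_eq (l : ℕ) : P.γOne l = P.Z l / P.Z 0 := by
  rw [γOne, γ_eq_smul_η, measureReal_def, Measure.smul_apply, measure_univ, smul_eq_mul, mul_one,
    ENNReal.toReal_ofReal (div_pos (P.Z_pos _) (P.Z_pos _)).le]

theorem integral_normWeight_mul (l : ℕ) (φ : E → ℝ) :
    ∫ u, P.normWeight l u * φ u ∂P.η l = ∫ u, φ u ∂P.η (l + 1) := by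
  rw [← withDensity_normWeight_η, integral_withDensity_eq_integral_toReal_smul
    (P.measurable_normWeight l).ennreal_ofReal (by simp)]
  refine integral_congr_ae (Eventually.of_forall fun u => ?_)
  simp [ENNReal.toReal_ofReal (P.normWeight_pos l u).le]

theorem integral_G (l : ℕ) : ∫ u, P.G l u ∂P.η l = P.Z (l + 1) / P.Z l := by
  have h := P.integral_normWeight_mul l fun _ => 1
  simp only [mul_one, integral_const, probReal_univ, smul_eq_mul] at h
  simp_rw [P.G_eq_mul_normWeight l]
  rw [integral_const_mul, h, mul_one]

/-! ### The look-ahead functions -/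

/-- The normalised Feynman–Kac semigroup applied to `1` over `k` steps from level `p`: the
conditional expectation of the remaining normalised weights `∏_{p ≤ q < p + k} g_q` along the chain
started in `u` at level `p`. -/
noncomputable def lookAhead : ℕ → ℕ → E → ℝ
  | 0, _, _ => 1
  | k + 1, p, u => P.normWeight p u * ∫ v, lookAhead k (p + 1) v ∂P.M (p + 1) u

theorem measurable_lookAhead (k p : ℕ) : Measurable (P.lookAhead k p) := by
  have := P.M_markov
  induction k generalizing p with
  | zero => exact measurable_const
  | succ k ih =>
    exact (P.measurable_normWeight p).mul
      (ih (p + 1)).stronglyMeasurable.integral_kernel.measurable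

theorem lookAhead_one (p : ℕ) : P.lookAhead 1 p = P.normWeight p := by
  have := P.M_markov
  ext u
  simp [lookAhead]

/-- The normalised weights `g_p` deviate from `1` by at most `D t^p`, uniformly in the particle. -/
def WeightDecay (D t : ℝ) : Prop := ∀ p u, |P.normWeight p u - 1| ≤ D * t ^ p

variable {P} {D t : ℝ}

/-- The bound is the telescoped form of `∏_{q ≥ p} (1 + D t^q) ≤ exp (D t^p / (1 - t))`. -/
theorem WeightDecay.abs_lookAhead_sub_one_le (hg : P.WeightDecay D t) (hD : 0 ≤ D) (ht : 0 ≤ t)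
    (ht1 : t < 1) (k p : ℕ) (u : E) :
    |P.lookAhead k p u - 1| ≤ Real.exp (D / (1 - t) * t ^ p) - 1 := by
  have := P.M_markov
  have h1t : 0 < 1 - t := by linarith
  induction k generalizing p u with
  | zero =>
    simp only [lookAhead, sub_self, abs_zero, sub_nonneg]
    exact Real.one_le_exp (by positivity)
  | succ k ih =>
    set a := Real.exp (D / (1 - t) * t ^ (p + 1)) - 1 with ha
    have ha0 : 0 ≤ a := (abs_nonneg _).trans (ih (p + 1) u)
    set I := ∫ v, P.lookAhead k (p + 1) v ∂P.M (p + 1) u with hI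
    have hint : Integrable (P.lookAhead k (p + 1)) (P.M (p + 1) u) := by
      refine Integrable.of_bound (P.measurable_lookAhead k _).aestronglyMeasurable (a + 1)
        (Eventually.of_forall fun v => ?_)
      have := abs_add_le (P.lookAhead k (p + 1) v - 1) 1
      rw [sub_add_cancel, abs_one] at this
      rw [Real.norm_eq_abs]
      linarith [ih (p + 1) v]
    have hI1 : |I - 1| ≤ a := by
      have h1 : I - 1 = ∫ v, (P.lookAhead k (p + 1) v - 1) ∂P.M (p + 1) u := by
        rw [integral_sub hint (integrable_const _)]; simp [hI]
      rw [h1]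
      have h2 : ∀ v, ‖P.lookAhead k (p + 1) v - 1‖ ≤ a := ih (p + 1)
      have h3 := norm_integral_le_of_norm_le_const (μ := P.M (p + 1) u) (Eventually.of_forall h2)
      simpa using h3
    have hδ := hg p u
    have hδ0 : 0 ≤ D * t ^ p := by positivity
    have hexp : Real.exp (D / (1 - t) * t ^ p) = Real.exp (D * t ^ p) * (1 + a) := by
      rw [ha, add_sub_cancel, ← Real.exp_add]
      congr 1
      field_simp
      ring
    have hle : 1 + D * t ^ p ≤ Real.exp (D * t ^ p) := by
      rw [add_comm]; exact Real.add_one_le_exp _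
    change |P.normWeight p u * I - 1| ≤ _
    have hsplit : P.normWeight p u * I - 1
        = (P.normWeight p u - 1) * (I - 1) + (P.normWeight p u - 1) + (I - 1) := by ring
    calc |P.normWeight p u * I - 1|
        ≤ |P.normWeight p u - 1| * |I - 1| + |P.normWeight p u - 1| + |I - 1| := by
          rw [hsplit, ← abs_mul]
          exact (abs_add_le _ _).trans (add_le_add_left (abs_add_le _ _) _)
      _ ≤ D * t ^ p * a + D * t ^ p + a := by gcongr
      _ = (1 + D * t ^ p) * (1 + a) - 1 := by ring
      _ ≤ Real.exp (D / (1 - t) * t ^ p) - 1 := by rw [hexp]; gcongr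

theorem WeightDecay.integral_lookAhead (hg : P.WeightDecay D t) (hD : 0 ≤ D) (ht : 0 ≤ t)
    (ht1 : t < 1) (k p : ℕ) : ∫ u, P.lookAhead k p u ∂P.η p = 1 := by
  have := P.M_markov
  induction k generalizing p with
  | zero => simp [lookAhead]
  | succ k ih =>
    have hint : Integrable (P.lookAhead k (p + 1)) (P.M (p + 1) ∘ₘ P.η (p + 1)) := by
      refine Integrable.of_bound (P.measurable_lookAhead k _).aestronglyMeasurable
        (Real.exp (D / (1 - t) * t ^ (p + 1)) - 1 + 1) (Eventually.of_forall fun v => ?_)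
      have := abs_add_le (P.lookAhead k (p + 1) v - 1) 1
      rw [sub_add_cancel, abs_one] at this
      rw [Real.norm_eq_abs]
      linarith [hg.abs_lookAhead_sub_one_le hD ht ht1 k (p + 1) v]
    calc ∫ u, P.lookAhead (k + 1) p u ∂P.η p
        = ∫ u, P.normWeight p u * ∫ v, P.lookAhead k (p + 1) v ∂P.M (p + 1) u ∂P.η p := rfl
      _ = ∫ u, ∫ v, P.lookAhead k (p + 1) v ∂P.M (p + 1) u ∂P.η (p + 1) :=
          P.integral_normWeight_mul p _
      _ = ∫ v, P.lookAhead k (p + 1) v ∂(P.M (p + 1) ∘ₘ P.η (p + 1)) :=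
          (Kernel.integral_comp (κ := Kernel.const Unit (P.η (p + 1))) (a := ()) hint).symm
      _ = 1 := by rw [P.η_bind, ih]

/-! ### One step of the particle system -/

variable (P) in
theorem integral_selMutMeasure (l : ℕ) {n : ℕ+} (u : Fin n → E) {φ : E → ℝ} (hφ : Measurable φ)
    {K : ℝ} (hK : ∀ x, |φ x| ≤ K) :
    (∫ v, φ v ∂P.selMutMeasure l u) * empMean (P.normWeight l) u
      = empMean (fun x => P.normWeight l x * ∫ v, φ v ∂P.M (l + 1) x) u := by
  have := P.M_markov
  have hn : (n : ℝ) ≠ 0 := by exact_mod_cast n.pos.ne'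
  have hint : ∀ x, Integrable φ (P.M (l + 1) x) := fun x =>
    Integrable.of_bound hφ.aestronglyMeasurable K (Eventually.of_forall hK)
  have hc := div_pos (P.Z_pos (l + 1)) (P.Z_pos l)
  have hS : 0 < ∑ i, P.normWeight l (u i) :=
    Finset.sum_pos (fun i _ => P.normWeight_pos l _) ⟨⟨0, n.pos⟩, Finset.mem_univ _⟩
  rw [selMutMeasure, integral_smul_measure, integral_finsetSum_measure
    (fun i _ => (hint _).smul_measure ENNReal.ofReal_ne_top)]
  simp only [integral_smul_measure, ENNReal.toReal_ofReal (P.G_pos _ _).le, ENNReal.toReal_inv,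
    ENNReal.toReal_sum (fun _ _ => ENNReal.ofReal_ne_top), smul_eq_mul, empMean]
  simp_rw [P.G_eq_mul_normWeight l, mul_assoc, ← Finset.mul_sum]
  have h1 := (P.Z_pos l).ne'
  have h2 := (P.Z_pos (l + 1)).ne'
  field_simp

variable (P) in
/-- Disintegration of the law of the particle system: given the populations up to level `p`, the
next one is drawn from `popKernel`. -/
theorem integral_smcLaw_succ (N : ℕ → ℕ+) (p : ℕ)
    (F : (∀ i : Finset.Iic p, Fin (N i) → E) → (Fin (N (p + 1)) → E) → ℝ)
    (hF : Measurable (Function.uncurry F)) {K : ℝ} (hK : ∀ w y, |F w y| ≤ K) :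
    ∫ U, F (Preorder.frestrictLe p U) (U (p + 1)) ∂P.smcLaw N
      = ∫ U, (∫ y, F (Preorder.frestrictLe p U) y ∂(Measure.pi fun _ => P.selMutMeasure p (U p)))
          ∂P.smcLaw N := by
  have hlaw : IsProbabilityMeasure (P.smcLaw N) := by unfold smcLaw; infer_instance
  let κ : Kernel (∀ i : Finset.Iic p, Fin (N i) → E) (Fin (N (p + 1)) → E) :=
    (P.popKernel p (N p) (N (p + 1))).comap (fun u => u ⟨p, Finset.mem_Iic.mpr le_rfl⟩)
      (measurable_pi_apply _)
  have key : (P.smcLaw N).map (Preorder.frestrictLe p) ⊗ₘ κ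
      = (P.smcLaw N).map (fun x => (Preorder.frestrictLe p x, x (p + 1))) :=
    Kernel.map_frestrictLe_trajMeasure_compProd_eq_map_trajMeasure
  have hr : Measurable (Preorder.frestrictLe p : (∀ l, Fin (N l) → E) → _) :=
    Preorder.measurable_frestrictLe p
  have : IsProbabilityMeasure ((P.smcLaw N).map (Preorder.frestrictLe p)) :=
    Measure.isProbabilityMeasure_map hr.aemeasurable
  have hint : Integrable (Function.uncurry F)
      ((P.smcLaw N).map (Preorder.frestrictLe p) ⊗ₘ κ) :=
    Integrable.of_bound hF.aestronglyMeasurable K (Eventually.of_forall fun z => hK z.1 z.2)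
  have h1 := integral_map (μ := P.smcLaw N)
    (φ := fun x : (∀ l, Fin (N l) → E) =>
      (Preorder.frestrictLe (π := fun l => Fin (N l) → E) p x, x (p + 1)))
    (f := Function.uncurry F) (hr.prodMk (measurable_pi_apply _)).aemeasurable
    hF.aestronglyMeasurable
  have h2 := Measure.integral_compProd hint
  rw [integral_map hr.aemeasurable
    hF.stronglyMeasurable.integral_kernel_prod_right'.aestronglyMeasurable] at h2
  rw [key] at h2
  exact h1.symm.trans h2

variable (P) in
theorem map_eval_zero_smcLaw (N : ℕ → ℕ+) :
    (P.smcLaw N).map (fun U => U 0) = Measure.pi fun _ : Fin (N 0) => P.η 0 := by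
  let e : (∀ i : Finset.Iic 0, Fin (N i) → E) → (Fin (N 0) → E) :=
    fun w => w ⟨0, Finset.mem_Iic.mpr le_rfl⟩
  have he : Measurable e := measurable_pi_apply _
  have hr : Measurable (Preorder.frestrictLe (π := fun l => Fin (N l) → E) 0) :=
    Preorder.measurable_frestrictLe 0
  change (P.smcLaw N).map (e ∘ Preorder.frestrictLe (π := fun l => Fin (N l) → E) 0) = _
  rw [← Measure.map_map he hr, smcLaw, Kernel.trajMeasure, Measure.map_comp _ _ hr,
    Kernel.traj_map_frestrictLe, Kernel.partialTraj_self, Measure.id_comp]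
  exact (Measure.map_map he (MeasurableEquiv.measurable _)).trans Measure.map_id

/-! ### The mean squared error of the estimator -/

section particles

variable {N : ℕ → ℕ+}

instance isProbabilityMeasure_smcLaw : IsProbabilityMeasure (P.smcLaw N) := by
  unfold smcLaw
  infer_instance

variable (P) in
/-- The estimator with the normalised weights, `∏_{q < p} η_q^{N_q}(g_q)`. -/
noncomputable def normEstimator (N : ℕ → ℕ+) (p : ℕ) (U : ∀ l, Fin (N l) → E) : ℝ :=
  ∏ q ∈ Finset.range p, empMean (P.normWeight q) (U q)

theorem normEstimator_pos (p : ℕ) (U : ∀ l, Fin (N l) → E) : 0 < P.normEstimator N p U :=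
  Finset.prod_pos fun q _ => empMean_pos (P.normWeight_pos q) (U q)

theorem measurable_normEstimator (p : ℕ) : Measurable (P.normEstimator N p) :=
  Finset.measurable_prod _ fun q _ =>
    (measurable_empMean (P.measurable_normWeight q)).comp (measurable_pi_apply q)

theorem estimator_eq_γOne_mul (L : ℕ) (U : ∀ l, Fin (N l) → E) :
    P.estimator N L U = P.γOne L * P.normEstimator N L U := by
  rw [γOne_eq]
  induction L with
  | zero => simp [estimator, normEstimator, (P.Z_pos 0).ne']
  | succ L ih =>
    have h1 := (P.Z_pos L).ne'
    have h2 := (P.Z_pos 0).ne'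
    rw [estimator, normEstimator, Finset.prod_range_succ, Finset.prod_range_succ]
    rw [estimator, normEstimator] at ih
    rw [ih]
    simp only [empMean, P.G_eq_mul_normWeight L, ← Finset.mul_sum]
    field_simp

theorem WeightDecay.abs_normWeight_le (hg : P.WeightDecay D t) (p : ℕ) (u : E) :
    |P.normWeight p u| ≤ 1 + D * t ^ p := by
  have := abs_add_le (P.normWeight p u - 1) 1
  rw [sub_add_cancel, abs_one] at this
  linarith [hg p u]

/-- The telescoped form of `∏_{q < p} (1 + D t^q) ≤ exp (∑_{q < p} D t^q)`. -/
theorem WeightDecay.normEstimator_le (hg : P.WeightDecay D t) (ht1 : t < 1) (p : ℕ)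
    (U : ∀ l, Fin (N l) → E) :
    P.normEstimator N p U ≤ Real.exp (D / (1 - t) * (1 - t ^ p)) := by
  have h1t : 0 < 1 - t := by linarith
  induction p with
  | zero => simp [normEstimator]
  | succ p ih =>
    have h1 : empMean (P.normWeight p) (U p) ≤ Real.exp (D * t ^ p) :=
      (le_abs_self _).trans <| (abs_empMean_le (hg.abs_normWeight_le p) (U p)).trans <| by
        rw [add_comm]; exact Real.add_one_le_exp _
    have h2 : Real.exp (D / (1 - t) * (1 - t ^ (p + 1)))
        = Real.exp (D / (1 - t) * (1 - t ^ p)) * Real.exp (D * t ^ p) := by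
      rw [← Real.exp_add]
      congr 1
      field_simp
      ring
    rw [normEstimator, Finset.prod_range_succ, h2]
    exact mul_le_mul ih h1 (empMean_pos (P.normWeight_pos p) _).le (Real.exp_pos _).le

theorem WeightDecay.normEstimator_le_exp (hg : P.WeightDecay D t) (hD : 0 ≤ D) (ht : 0 ≤ t)
    (ht1 : t < 1) (p : ℕ) (U : ∀ l, Fin (N l) → E) :
    P.normEstimator N p U ≤ Real.exp (D / (1 - t)) := by
  refine (hg.normEstimator_le ht1 p U).trans (Real.exp_le_exp.mpr ?_)
  exact mul_le_of_le_one_right (div_nonneg hD (by linarith)) (by linarith [pow_nonneg ht p])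

/-- The martingale `X_p η_p^N(f_p)`, with `X_p` the normalised estimator and `f_p` the look-ahead
function: one step of it costs the conditional variance of a single population. -/
theorem WeightDecay.integral_sq_sub_one_succ_le (hg : P.WeightDecay D t) (hD : 0 ≤ D) (ht : 0 ≤ t)
    (ht1 : t < 1) (k p : ℕ) :
    ∫ U, (P.normEstimator N (p + 1) U * empMean (P.lookAhead k (p + 1)) (U (p + 1)) - 1) ^ 2
        ∂P.smcLaw N
      ≤ ∫ U, (P.normEstimator N p U * empMean (P.lookAhead (k + 1) p) (U p) - 1) ^ 2 ∂P.smcLaw N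
        + Real.exp (D / (1 - t)) ^ 2
          * ((Real.exp (D / (1 - t) * t ^ (p + 1)) - 1) ^ 2 / N (p + 1)) := by
  set B := Real.exp (D / (1 - t)) with hB
  set a := Real.exp (D / (1 - t) * t ^ (p + 1)) - 1 with ha
  have hfa : ∀ x, |P.lookAhead k (p + 1) x - 1| ≤ a := hg.abs_lookAhead_sub_one_le hD ht ht1 k _
  have hfb : ∀ k' p' x, |P.lookAhead k' p' x| ≤ Real.exp (D / (1 - t) * t ^ p') := by
    intro k' p' x
    have := abs_add_le (P.lookAhead k' p' x - 1) 1
    rw [sub_add_cancel, abs_one] at this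
    linarith [hg.abs_lookAhead_sub_one_le hD ht ht1 k' p' x]
  let F : (∀ i : Finset.Iic p, Fin (N i) → E) → (Fin (N (p + 1)) → E) → ℝ := fun w y =>
    (min (∏ q : Finset.Iic p, empMean (P.normWeight q) (w q)) B
      * empMean (P.lookAhead k (p + 1)) y - 1) ^ 2
  -- Truncation at `B` makes `F` bounded and does not change it along trajectories.
  have hX : ∀ U : (∀ l, Fin (N l) → E),
      min (∏ q : Finset.Iic p, empMean (P.normWeight q)
        (Preorder.frestrictLe (π := fun l => Fin (N l) → E) p U q)) B
        = P.normEstimator N (p + 1) U := by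
    intro U
    have h1 : ∏ q : Finset.Iic p, empMean (P.normWeight q)
        (Preorder.frestrictLe (π := fun l => Fin (N l) → E) p U q)
        = P.normEstimator N (p + 1) U := by
      rw [normEstimator, Nat.range_succ_eq_Iic]
      exact Finset.prod_coe_sort (Finset.Iic p) fun q => empMean (P.normWeight q) (U q)
    rw [h1]
    exact min_eq_left (hg.normEstimator_le_exp hD ht ht1 _ U)
  have hFm : Measurable (Function.uncurry F) := by
    refine (((Measurable.min (Finset.measurable_prod _ fun q _ => ?_)
      measurable_const).mul ?_).sub_const 1).pow_const 2
    · exact (measurable_empMean (P.measurable_normWeight q)).comp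
        ((measurable_pi_apply q).comp measurable_fst)
    · exact (measurable_empMean (P.measurable_lookAhead k _)).comp measurable_snd
  have hFb : ∀ w y, |F w y| ≤ (B * Real.exp (D / (1 - t) * t ^ (p + 1)) + 1) ^ 2 := by
    intro w y
    have h0 : 0 < ∏ q : Finset.Iic p, empMean (P.normWeight q) (w q) :=
      Finset.prod_pos fun q _ => empMean_pos (P.normWeight_pos q) _
    have h1 : |min (∏ q : Finset.Iic p, empMean (P.normWeight q) (w q)) B| ≤ B := by
      rw [abs_of_pos (lt_min h0 (Real.exp_pos _))]
      exact min_le_right _ _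
    have h2 := abs_empMean_le (hfb k (p + 1)) y
    simp only [F]
    rw [abs_pow]
    refine pow_le_pow_left₀ (abs_nonneg _) ((abs_sub _ _).trans ?_) 2
    rw [abs_mul, abs_one]
    gcongr
  have hstep := P.integral_smcLaw_succ N p F hFm hFb
  simp only [F, hX] at hstep
  rw [hstep]
  have hYm : Measurable fun U : (∀ l, Fin (N l) → E) =>
      (P.normEstimator N p U * empMean (P.lookAhead (k + 1) p) (U p) - 1) ^ 2 :=
    (((measurable_normEstimator p).mul ((measurable_empMean (P.measurable_lookAhead _ _)).comp
      (measurable_pi_apply p))).sub_const 1).pow_const 2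
  have hYint : Integrable (fun U : (∀ l, Fin (N l) → E) =>
      (P.normEstimator N p U * empMean (P.lookAhead (k + 1) p) (U p) - 1) ^ 2) (P.smcLaw N) := by
    refine Integrable.of_bound hYm.aestronglyMeasurable
      ((B * Real.exp (D / (1 - t) * t ^ p) + 1) ^ 2) (Eventually.of_forall fun U => ?_)
    rw [Real.norm_eq_abs, abs_pow]
    refine pow_le_pow_left₀ (abs_nonneg _) ((abs_sub _ _).trans ?_) 2
    rw [abs_mul, abs_one, abs_of_pos (normEstimator_pos p U)]
    have := abs_empMean_le (hfb (k + 1) p) (U p)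
    have := hg.normEstimator_le_exp hD ht ht1 p U
    gcongr
  calc _ ≤ ∫ U, ((P.normEstimator N p U * empMean (P.lookAhead (k + 1) p) (U p) - 1) ^ 2
        + B ^ 2 * (a ^ 2 / N (p + 1))) ∂P.smcLaw N := by
        refine integral_mono_of_nonneg (Eventually.of_forall fun U => ?_)
          (hYint.add (integrable_const _)) (Eventually.of_forall fun U => ?_)
        · exact integral_nonneg fun y => sq_nonneg _
        · refine (integral_sq_mul_empMean_sub_one_le (P.selMutMeasure p (U p))
            (P.measurable_lookAhead k (p + 1)) hfa _).trans ?_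
          have hsel := P.integral_selMutMeasure p (U p) (P.measurable_lookAhead k (p + 1))
            (hfb k (p + 1))
          have hY : P.normEstimator N (p + 1) U
              * ∫ v, P.lookAhead k (p + 1) v ∂P.selMutMeasure p (U p)
              = P.normEstimator N p U * empMean (P.lookAhead (k + 1) p) (U p) := by
            rw [normEstimator, Finset.prod_range_succ, mul_assoc,
              mul_comm (empMean (P.normWeight p) (U p)), hsel]
            rfl
          rw [hY]
          exact add_le_add le_rfl (mul_le_mul_of_nonneg_right (pow_le_pow_left₀
            (normEstimator_pos (P := P) (p + 1) U).le
            (hg.normEstimator_le_exp hD ht ht1 (p + 1) U) 2) (by positivity))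
    _ = _ := by
        rw [integral_add hYint (integrable_const _)]
        simp

theorem WeightDecay.integral_sq_sub_one_le (hg : P.WeightDecay D t) (hD : 0 ≤ D) (ht : 0 ≤ t)
    (ht1 : t < 1) (k p : ℕ) :
    ∫ U, (P.normEstimator N p U * empMean (P.lookAhead k p) (U p) - 1) ^ 2 ∂P.smcLaw N
      ≤ ∑ q ∈ Finset.range (p + 1), Real.exp (D / (1 - t)) ^ 2
          * ((Real.exp (D / (1 - t) * t ^ q) - 1) ^ 2 / N q) := by
  induction p generalizing k with
  | zero =>
    have hm : Measurable fun y : Fin (N 0) → E => (1 * empMean (P.lookAhead k 0) y - 1) ^ 2 :=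
      (((measurable_empMean (P.measurable_lookAhead k 0)).const_mul 1).sub_const 1).pow_const 2
    have h := integral_sq_mul_empMean_sub_one_le (n := N 0) (P.η 0) (P.measurable_lookAhead k 0)
      (hg.abs_lookAhead_sub_one_le hD ht ht1 k 0) 1
    rw [← map_eval_zero_smcLaw P N, integral_map (measurable_pi_apply 0).aemeasurable
      hm.aestronglyMeasurable, hg.integral_lookAhead hD ht ht1] at h
    simp only [normEstimator, Finset.range_zero, Finset.prod_empty, zero_add, Finset.sum_range_one]
    refine h.trans ?_
    have hB : 1 ≤ Real.exp (D / (1 - t)) :=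
      Real.one_le_exp (div_nonneg hD (by linarith))
    have : (0 : ℝ) ≤ (Real.exp (D / (1 - t) * t ^ 0) - 1) ^ 2 / N 0 := by positivity
    rw [mul_one, sub_self, one_pow, one_mul, zero_pow two_ne_zero, zero_add]
    exact le_mul_of_one_le_left this (one_le_pow₀ hB)
  | succ p ih =>
    rw [Finset.sum_range_succ]
    exact (hg.integral_sq_sub_one_succ_le hD ht ht1 k p).trans (add_le_add_left (ih (k + 1)) _)

/-- The relative variance of the estimator: `X_L` is the martingale above at level `L - 1`. -/
theorem WeightDecay.integral_normEstimator_sub_one_sq_le (hg : P.WeightDecay D t) (hD : 0 ≤ D)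
    (ht : 0 ≤ t) (ht1 : t < 1) {L : ℕ} (hL : 1 ≤ L) :
    ∫ U, (P.normEstimator N L U - 1) ^ 2 ∂P.smcLaw N
      ≤ (D / (1 - t) * Real.exp (D / (1 - t)) ^ 2) ^ 2
        * ∑ q ∈ Finset.range L, (t ^ q) ^ 2 / N q := by
  obtain ⟨p, rfl⟩ : ∃ p, L = p + 1 := ⟨L - 1, by omega⟩
  have h := hg.integral_sq_sub_one_le (N := N) hD ht ht1 1 p
  simp_rw [P.lookAhead_one p] at h
  simp_rw [normEstimator, Finset.prod_range_succ]
  refine h.trans ?_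
  rw [Finset.mul_sum]
  refine Finset.sum_le_sum fun q _ => ?_
  set c := D / (1 - t) with hc
  have hc0 : 0 ≤ c := div_nonneg hD (by linarith)
  have hx0 : 0 ≤ c * t ^ q := by positivity
  have hx1 : c * t ^ q ≤ c := mul_le_of_le_one_right hc0 (pow_le_one₀ ht ht1.le)
  have hle : Real.exp (c * t ^ q) - 1 ≤ c * t ^ q * Real.exp c := by
    have h1 := Real.one_sub_le_exp_neg (c * t ^ q)
    have h2 : Real.exp (-(c * t ^ q)) * Real.exp (c * t ^ q) = 1 := by
      rw [← Real.exp_add]; simp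
    have h3 : (1 - c * t ^ q) * Real.exp (c * t ^ q) ≤ 1 :=
      (mul_le_mul_of_nonneg_right h1 (Real.exp_pos _).le).trans_eq h2
    have h4 : c * t ^ q * Real.exp (c * t ^ q) ≤ c * t ^ q * Real.exp c := by gcongr
    linarith
  have h0 : 0 ≤ Real.exp (c * t ^ q) - 1 := sub_nonneg.mpr (Real.one_le_exp hx0)
  calc Real.exp c ^ 2 * ((Real.exp (c * t ^ q) - 1) ^ 2 / N q)
      ≤ Real.exp c ^ 2 * ((c * t ^ q * Real.exp c) ^ 2 / N q) := by gcongr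
    _ = (c * Real.exp c ^ 2) ^ 2 * ((t ^ q) ^ 2 / N q) := by ring

theorem WeightDecay.integrable_estimator_sub_sq (hg : P.WeightDecay D t) (hD : 0 ≤ D)
    (ht : 0 ≤ t) (ht1 : t < 1) (L : ℕ) (x y : ℝ) :
    Integrable (fun U => (x * P.normEstimator N L U - y) ^ 2) (P.smcLaw N) := by
  refine Integrable.of_bound
    ((((measurable_normEstimator L).const_mul x).sub_const y).pow_const 2).aestronglyMeasurable
    ((|x| * Real.exp (D / (1 - t)) + |y|) ^ 2) (Eventually.of_forall fun U => ?_)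
  rw [Real.norm_eq_abs, abs_pow]
  refine pow_le_pow_left₀ (abs_nonneg _) ((abs_sub _ _).trans ?_) 2
  rw [abs_mul, abs_of_pos (normEstimator_pos L U)]
  have := hg.normEstimator_le_exp hD ht ht1 L U
  gcongr

/-- The mean squared relative error: variance and squared bias. -/
theorem WeightDecay.mse_le (hg : P.WeightDecay D t) (hD : 0 ≤ D)
    (ht : 0 ≤ t) (ht1 : t < 1) {L : ℕ} (hL : 1 ≤ L) :
    1 / P.γInfOne ^ 2 * ∫ U, (P.estimator N L U - P.γInfOne) ^ 2 ∂P.smcLaw N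
      ≤ 2 * (P.γOne L / P.γInfOne) ^ 2 * ((D / (1 - t) * Real.exp (D / (1 - t)) ^ 2) ^ 2
          * ∑ q ∈ Finset.range L, (t ^ q) ^ 2 / N q)
        + 2 * (P.γOne L / P.γInfOne - 1) ^ 2 := by
  have hγ : P.γInfOne ≠ 0 := (div_pos P.κInf_integral_pos (P.Z_pos 0)).ne'
  set r := P.γOne L / P.γInfOne with hr
  have hint1 := hg.integrable_estimator_sub_sq (N := N) hD ht ht1 L 1 1
  simp only [one_mul] at hint1
  rw [← integral_const_mul]
  calc ∫ U, 1 / P.γInfOne ^ 2 * (P.estimator N L U - P.γInfOne) ^ 2 ∂P.smcLaw N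
      ≤ ∫ U, (2 * r ^ 2 * (P.normEstimator N L U - 1) ^ 2 + 2 * (r - 1) ^ 2) ∂P.smcLaw N := by
        refine integral_mono_of_nonneg (Eventually.of_forall fun U => by positivity)
          ((hint1.const_mul _).add (integrable_const _)) (Eventually.of_forall fun U => ?_)
        have h1 : 1 / P.γInfOne ^ 2 * (P.estimator N L U - P.γInfOne) ^ 2
            = (r * (P.normEstimator N L U - 1) + (r - 1)) ^ 2 := by
          rw [estimator_eq_γOne_mul, hr]
          field_simp
          ring
        simp only [h1]
        have := add_sq_le (a := r * (P.normEstimator N L U - 1)) (b := r - 1)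
        linarith [mul_pow r (P.normEstimator N L U - 1) 2]
    _ = 2 * r ^ 2 * ∫ U, (P.normEstimator N L U - 1) ^ 2 ∂P.smcLaw N + 2 * (r - 1) ^ 2 := by
        rw [integral_add (hint1.const_mul _) (integrable_const _), integral_const_mul]
        simp
    _ ≤ _ := by
        have := hg.integral_normEstimator_sub_one_sq_le (N := N) hD ht ht1 hL
        gcongr

end particles

end MLSMCModel

/-! ### Choice of the level and of the particle numbers -/

theorem pow_rpow_eq_rpow_half_pow_sq {m : ℝ} (hm : 0 < m) (p : ℕ) (s : ℝ) :
    (m ^ p) ^ s = ((m ^ (s / 2)) ^ p) ^ 2 := by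
  rw [← Real.rpow_natCast, ← Real.rpow_natCast, ← Real.rpow_natCast, ← Real.rpow_mul hm.le,
    ← Real.rpow_mul hm.le, ← Real.rpow_mul hm.le]
  congr 1
  push_cast
  ring

theorem sum_range_pow_le {x : ℝ} (hx : 1 < x) (L : ℕ) :
    ∑ p ∈ Finset.range L, x ^ p ≤ x ^ L / (x - 1) := by
  rw [geom_sum_eq hx.ne']
  have : 0 < x - 1 := by linarith
  gcongr
  linarith

/-- The particle numbers `N_p ≈ ε⁻² S (b z)^{-p}` with `S = ∑_{q < L} (z / b)^q` minimise the cost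
`∑ N_p z^{2 p}` for the variance `∑ b^{-2 p} / N_p = ε²`, up to rounding. -/
theorem exists_antitone_particleNumbers {b z ε : ℝ} (hb : 0 < b) (hz : 0 < z) (hbz : 1 ≤ b * z)
    (hε : 0 < ε) {L : ℕ} (hL : 1 ≤ L) :
    ∃ N : ℕ → ℕ+, Antitone N ∧
      ∑ p ∈ Finset.range L, (b⁻¹ ^ p) ^ 2 / (N p : ℝ) ≤ ε ^ 2 ∧
      ∑ p ∈ Finset.range L, (N p : ℝ) * (z ^ p) ^ 2
        ≤ ∑ p ∈ Finset.range L, (z ^ 2) ^ p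
          + (ε ^ 2)⁻¹ * (∑ p ∈ Finset.range L, (z / b) ^ p) ^ 2 := by
  set S := ∑ p ∈ Finset.range L, (z / b) ^ p with hS
  have hS0 : 0 < S := Finset.sum_pos (fun p _ => by positivity)
    (Finset.nonempty_range_iff.mpr (by omega))
  have hx0 : ∀ p : ℕ, 0 < (ε ^ 2)⁻¹ * S / (b * z) ^ p := fun p => by positivity
  refine ⟨fun p => ⟨⌈(ε ^ 2)⁻¹ * S / (b * z) ^ p⌉₊, Nat.ceil_pos.mpr (hx0 p)⟩, ?_, ?_, ?_⟩
  · intro p q hpq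
    refine Subtype.mk_le_mk.mpr (Nat.ceil_mono ?_)
    have := pow_le_pow_right₀ hbz hpq
    gcongr
  · calc _ ≤ ∑ p ∈ Finset.range L, ε ^ 2 / S * (z / b) ^ p := by
          refine Finset.sum_le_sum fun p _ => ?_
          calc _ ≤ (b⁻¹ ^ p) ^ 2 / ((ε ^ 2)⁻¹ * S / (b * z) ^ p) := by
                refine div_le_div_of_nonneg_left (by positivity) (hx0 p) ?_
                exact Nat.le_ceil _
            _ = ε ^ 2 / S * (z / b) ^ p := by
                rw [mul_pow, inv_pow, div_pow]
                field_simp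
      _ = ε ^ 2 := by
          rw [← Finset.mul_sum, ← hS]
          field_simp
  · calc _ ≤ ∑ p ∈ Finset.range L, ((z ^ 2) ^ p + (ε ^ 2)⁻¹ * S * (z / b) ^ p) := by
          refine Finset.sum_le_sum fun p _ => ?_
          calc _ ≤ ((ε ^ 2)⁻¹ * S / (b * z) ^ p + 1) * (z ^ p) ^ 2 :=
                mul_le_mul_of_nonneg_right (Nat.ceil_lt_add_one (hx0 p).le).le (by positivity)
            _ = (z ^ 2) ^ p + (ε ^ 2)⁻¹ * S * (z / b) ^ p := by
                rw [mul_pow, div_pow, pow_right_comm z p 2]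
                field_simp
                ring
      _ = _ := by
          rw [Finset.sum_add_distrib, ← Finset.mul_sum, ← hS]
          ring

section rates

variable {α β ζ ε₀ : ℝ}

theorem abs_log_le_abs_log (hε₁ : ε₀ < 1) {ε : ℝ} (hε : 0 < ε) (h : ε ≤ ε₀) : |Real.log ε₀| ≤ |Real.log ε| := by
  have hl := Real.log_le_log hε h
  have := Real.log_neg (hε.trans_le h) hε₁
  rw [abs_of_neg this, abs_of_nonpos (by linarith)]
  linarith

theorem exists_inv_sq_le_costRate (hα : 0 < α) (hε₀ : 0 < ε₀) (hε₁ : ε₀ < 1) :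
    ∃ K : ℝ, 0 < K ∧ ∀ ε : ℝ, 0 < ε → ε ≤ ε₀ → (ε ^ 2)⁻¹ ≤ K * costRate α β ζ ε := by
  have hl : 0 < |Real.log ε₀| := abs_pos.mpr (Real.log_neg hε₀ hε₁).ne
  refine ⟨|Real.log ε₀|⁻¹ + (|Real.log ε₀| ^ 3)⁻¹, by positivity, fun ε hε hεε => ?_⟩
  have hll := abs_log_le_abs_log hε₁ hε hεε
  have h2 : ε ^ (-2 : ℝ) = (ε ^ 2)⁻¹ := by
    rw [Real.rpow_neg hε.le]; norm_num
  have h1 : 1 ≤ |Real.log ε₀|⁻¹ * |Real.log ε| := by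
    rw [inv_mul_eq_div, one_le_div hl]; exact hll
  have h3 : 1 ≤ (|Real.log ε₀| ^ 3)⁻¹ * |Real.log ε| ^ 3 := by
    rw [inv_mul_eq_div, one_le_div (by positivity)]; gcongr
  have hi : 0 < (ε ^ 2)⁻¹ := by positivity
  have hl3 : 0 ≤ (|Real.log ε₀| ^ 3)⁻¹ := by positivity
  have hl1 : 0 ≤ |Real.log ε₀|⁻¹ := by positivity
  -- The power of `ε` in the rate is at least `ε⁻²` in each case.
  have main : ∀ x : ℝ, (ε ^ 2)⁻¹ ≤ x →
      (ε ^ 2)⁻¹ ≤ (|Real.log ε₀|⁻¹ + (|Real.log ε₀| ^ 3)⁻¹) * (x * |Real.log ε|) := by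
    intro x hx
    have hx0 := hi.trans_le hx
    calc (ε ^ 2)⁻¹ ≤ x * 1 := by rwa [mul_one]
      _ ≤ x * (|Real.log ε₀|⁻¹ * |Real.log ε|) := by gcongr
      _ ≤ x * ((|Real.log ε₀|⁻¹ + (|Real.log ε₀| ^ 3)⁻¹) * |Real.log ε|) := by
          gcongr; linarith
      _ = _ := by ring
  unfold costRate
  split_ifs with hc1 hc2
  · exact main _ h2.ge
  · rw [h2]
    calc (ε ^ 2)⁻¹ = (ε ^ 2)⁻¹ * 1 := (mul_one _).symm
      _ ≤ (ε ^ 2)⁻¹ * ((|Real.log ε₀| ^ 3)⁻¹ * |Real.log ε| ^ 3) := by gcongr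
      _ ≤ (ε ^ 2)⁻¹ * ((|Real.log ε₀|⁻¹ + (|Real.log ε₀| ^ 3)⁻¹) * |Real.log ε| ^ 3) := by
          gcongr; linarith
      _ = _ := by ring
  · refine main _ ?_
    rw [← h2]
    refine Real.rpow_le_rpow_of_exponent_ge hε (hεε.trans hε₁.le) ?_
    have : 0 ≤ (ζ - β) / α := div_nonneg (by linarith) hα.le
    linarith

/-- The dominant part of the cost: `S = ∑_{p < L} (z / b)^p` is bounded, equal to `L`, or of the
order of its last term, according to the sign of `ζ - β`. -/
theorem exists_sum_sq_le_costRate (hα : 0 < α) {m : ℝ} (hm : 1 < m) (hε₀ : 0 < ε₀)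
    (hε₁ : ε₀ < 1) :
    ∃ K : ℝ, 0 < K ∧ ∀ ε : ℝ, 0 < ε → ε ≤ ε₀ → ∀ n : ℕ, (m ^ α) ^ n ≤ ε⁻¹ →
      (ε ^ 2)⁻¹ * (∑ p ∈ Finset.range (n + 1), (m ^ (ζ / 2) / m ^ (β / 2)) ^ p) ^ 2
        ≤ K * costRate α β ζ ε := by
  obtain ⟨K₀, hK₀, hK⟩ := exists_inv_sq_le_costRate (α := α) (β := β) (ζ := ζ) hα hε₀ hε₁
  have hm0 : 0 < m := by linarith
  have hl : 0 < |Real.log ε₀| := abs_pos.mpr (Real.log_neg hε₀ hε₁).ne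
  have hx : m ^ (ζ / 2) / m ^ (β / 2) = m ^ ((ζ - β) / 2) := by
    rw [← Real.rpow_sub hm0]; congr 1; ring
  rw [hx]
  set x := m ^ ((ζ - β) / 2) with hxdef
  have hx0 : 0 < x := Real.rpow_pos_of_pos hm0 _
  have h2 : ∀ ε : ℝ, 0 < ε → ε ^ (-2 : ℝ) = (ε ^ 2)⁻¹ := fun ε hε => by
    rw [Real.rpow_neg hε.le]; norm_num
  rcases lt_trichotomy β ζ with hlt | heq | hgt
  · have hx1 : 1 < x := Real.one_lt_rpow hm (by linarith)
    have hx1' : 0 < x - 1 := by linarith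
    refine ⟨(x / (x - 1)) ^ 2 * |Real.log ε₀|⁻¹, by positivity, fun ε hε hεε n hn => ?_⟩
    have hll := abs_log_le_abs_log hε₁ hε hεε
    have h1 : 1 ≤ |Real.log ε₀|⁻¹ * |Real.log ε| := by
      rw [inv_mul_eq_div, one_le_div hl]; exact hll
    have hxn : (x ^ n) ^ 2 ≤ ε ^ (-((ζ - β) / α)) := by
      rw [hxdef, ← pow_rpow_eq_rpow_half_pow_sq hm0]
      calc (m ^ n) ^ (ζ - β) = ((m ^ α) ^ n) ^ ((ζ - β) / α) := by
            rw [← Real.rpow_natCast, ← Real.rpow_natCast, ← Real.rpow_mul hm0.le,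
              ← Real.rpow_mul hm0.le, ← Real.rpow_mul hm0.le]
            congr 1
            field_simp
        _ ≤ (ε⁻¹) ^ ((ζ - β) / α) :=
            Real.rpow_le_rpow (by positivity) hn (div_nonneg (by linarith) hα.le)
        _ = _ := by rw [Real.inv_rpow hε.le, Real.rpow_neg hε.le]
    have hrate : costRate α β ζ ε
        = (ε ^ 2)⁻¹ * ε ^ (-((ζ - β) / α)) * |Real.log ε| := by
      rw [costRate, if_neg hlt.le.not_gt, if_neg hlt.ne, neg_add, Real.rpow_add hε, h2 ε hε]
    have hsum := sum_range_pow_le hx1 (n + 1)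
    have hsum0 : 0 ≤ ∑ p ∈ Finset.range (n + 1), x ^ p :=
      Finset.sum_nonneg fun _ _ => by positivity
    calc _ ≤ (ε ^ 2)⁻¹ * (x ^ (n + 1) / (x - 1)) ^ 2 := by gcongr
      _ = (ε ^ 2)⁻¹ * ((x / (x - 1)) ^ 2 * (x ^ n) ^ 2) := by rw [pow_succ]; ring
      _ ≤ (ε ^ 2)⁻¹ * ((x / (x - 1)) ^ 2 * ε ^ (-((ζ - β) / α))) := by gcongr
      _ = (ε ^ 2)⁻¹ * ((x / (x - 1)) ^ 2 * ε ^ (-((ζ - β) / α))) * 1 := (mul_one _).symm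
      _ ≤ (ε ^ 2)⁻¹ * ((x / (x - 1)) ^ 2 * ε ^ (-((ζ - β) / α)))
            * (|Real.log ε₀|⁻¹ * |Real.log ε|) := by gcongr
      _ = _ := by rw [hrate]; ring
  · have hx1 : x = 1 := by rw [hxdef, heq, sub_self, zero_div, Real.rpow_zero]
    have hA : 0 < α * Real.log m := mul_pos hα (Real.log_pos hm)
    refine ⟨((α * Real.log m)⁻¹ + |Real.log ε₀|⁻¹) ^ 2 * |Real.log ε₀|⁻¹, by positivity,
      fun ε hε hεε n hn => ?_⟩
    have hll := abs_log_le_abs_log hε₁ hε hεε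
    have h1 : 1 ≤ |Real.log ε₀|⁻¹ * |Real.log ε| := by
      rw [inv_mul_eq_div, one_le_div hl]; exact hll
    have hlog : |Real.log ε| = Real.log ε⁻¹ := by
      rw [Real.log_inv, abs_of_nonpos (Real.log_nonpos hε.le (hεε.trans hε₁.le))]
    have hn1 : (n : ℝ) ≤ (α * Real.log m)⁻¹ * |Real.log ε| := by
      have h := Real.log_le_log (by positivity) hn
      rw [Real.log_pow, Real.log_rpow hm0, ← hlog] at h
      rw [inv_mul_eq_div, le_div_iff₀ hA]
      exact h
    have hrate : costRate α β ζ ε = (ε ^ 2)⁻¹ * |Real.log ε| ^ 3 := by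
      rw [costRate, if_neg heq.le.not_gt, if_pos heq, h2 ε hε]
    have hsum : ∑ p ∈ Finset.range (n + 1), x ^ p = n + 1 := by simp [hx1]
    rw [hsum, hrate]
    calc _ ≤ (ε ^ 2)⁻¹ * ((α * Real.log m)⁻¹ * |Real.log ε|
            + |Real.log ε₀|⁻¹ * |Real.log ε|) ^ 2 := by gcongr
      _ = (ε ^ 2)⁻¹ * ((α * Real.log m)⁻¹ * |Real.log ε|
            + |Real.log ε₀|⁻¹ * |Real.log ε|) ^ 2 * 1 := (mul_one _).symm
      _ ≤ (ε ^ 2)⁻¹ * ((α * Real.log m)⁻¹ * |Real.log ε|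
            + |Real.log ε₀|⁻¹ * |Real.log ε|) ^ 2 * (|Real.log ε₀|⁻¹ * |Real.log ε|) := by gcongr
      _ = _ := by ring
  · have hx1 : x < 1 := Real.rpow_lt_one_of_one_lt_of_neg hm (by linarith)
    have hx1' : 0 < 1 - x := by linarith
    refine ⟨((1 - x)⁻¹) ^ 2 * K₀, by positivity, fun ε hε hεε n hn => ?_⟩
    have hsum : ∑ p ∈ Finset.range (n + 1), x ^ p ≤ (1 - x)⁻¹ := by
      rw [geom_sum_eq hx1.ne, ← neg_div_neg_eq, neg_sub, neg_sub, inv_eq_one_div]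
      gcongr
      linarith [pow_pos hx0 (n + 1)]
    have hsum0 : 0 ≤ ∑ p ∈ Finset.range (n + 1), x ^ p :=
      Finset.sum_nonneg fun _ _ => by positivity
    calc _ ≤ (ε ^ 2)⁻¹ * ((1 - x)⁻¹) ^ 2 := by gcongr
      _ ≤ (K₀ * costRate α β ζ ε) * ((1 - x)⁻¹) ^ 2 := by gcongr; exact hK ε hε hεε
      _ = _ := by ring

/-- The cost of one particle per level: rounding the particle numbers up is harmless because
`ζ ≤ 2 α`. -/
theorem exists_sum_le_inv_sq (hζ : 0 < ζ) (hαζ : ζ ≤ 2 * α) {m : ℝ} (hm : 1 < m) :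
    ∃ K : ℝ, 0 < K ∧ ∀ ε : ℝ, 0 < ε → ε ≤ 1 → ∀ n : ℕ, (m ^ α) ^ n ≤ ε⁻¹ →
      ∑ p ∈ Finset.range (n + 1), ((m ^ (ζ / 2)) ^ 2) ^ p ≤ K * (ε ^ 2)⁻¹ := by
  have hm0 : 0 < m := by linarith
  set z := m ^ (ζ / 2) with hzdef
  have hz1 : 1 < z := Real.one_lt_rpow hm (by linarith)
  have hz2 : 1 < z ^ 2 := one_lt_pow₀ hz1 two_ne_zero
  have hz2' : 0 < z ^ 2 - 1 := by linarith
  refine ⟨z ^ 2 / (z ^ 2 - 1), by positivity, fun ε hε hε1 n hn => ?_⟩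
  have hzn : (z ^ 2) ^ n ≤ (ε ^ 2)⁻¹ := by
    rw [pow_right_comm, hzdef, ← pow_rpow_eq_rpow_half_pow_sq hm0]
    calc (m ^ n) ^ ζ ≤ (m ^ n) ^ (2 * α) :=
          Real.rpow_le_rpow_of_exponent_le (one_le_pow₀ hm.le) hαζ
      _ = ((m ^ α) ^ n) ^ 2 := by
          rw [pow_rpow_eq_rpow_half_pow_sq hm0, mul_div_cancel_left₀ _ two_ne_zero]
      _ ≤ (ε⁻¹) ^ 2 := by gcongr
      _ = _ := inv_pow _ _
  calc _ ≤ (z ^ 2) ^ (n + 1) / (z ^ 2 - 1) := sum_range_pow_le hz2 _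
    _ = z ^ 2 / (z ^ 2 - 1) * (z ^ 2) ^ n := by rw [pow_succ]; ring
    _ ≤ _ := by gcongr

end rates

namespace MLSMCModel

variable {E : Type*} [MeasurableSpace E] {P : MLSMCModel E}

/-! ### Consequences of the rate assumptions -/

/-- The bounds on the densities make the supremum finite, so that `supNorm` does not take its
junk value `0`. -/
theorem UniformBounds.abs_normWeight_sub_one_le_supNorm (h : P.UniformBounds) (p : ℕ) (u : E) :
    |P.normWeight p u - 1|
      ≤ supNorm fun u => P.G p u / (∫ v, P.G p v ∂P.η p) - 1 := by
  obtain ⟨c, C, hc, hcC, hb⟩ := h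
  have hZ := div_pos (P.Z_pos (p + 1)) (P.Z_pos p)
  have hbdd : BddAbove (Set.range fun u => |P.G p u / (∫ v, P.G p v ∂P.η p) - 1|) := by
    refine ⟨C / c / (P.Z (p + 1) / P.Z p) + 1, ?_⟩
    rintro _ ⟨u, rfl⟩
    refine (abs_sub _ _).trans ?_
    rw [P.integral_G, abs_one, abs_of_pos (div_pos (P.G_pos p u) hZ), G]
    have h1 := (hb (p + 1) u).2
    have h2 := (hb p u).1
    have h3 : 0 < C := hc.trans hcC
    gcongr
  have := le_ciSup hbdd u
  rw [supNorm, normWeight]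
  simpa only [P.integral_G] using this

theorem WeightRate.weightDecay {β : ℝ} (hβ : 0 < β) (hw : P.WeightRate β)
    (hA : P.UniformBounds) {m C : ℝ} (hm : 1 < m) (hh : ∀ l : ℕ, P.h l ≤ C * (m ^ l)⁻¹) :
    ∃ D : ℝ, 0 ≤ D ∧ P.WeightDecay D (m ^ (β / 2))⁻¹ := by
  obtain ⟨K, hK, hw⟩ := hw
  have hm0 : 0 < m := by linarith
  have hC : 0 < C := by simpa using (P.h_pos 0).trans_le (hh 0)
  refine ⟨√(K * C ^ β), Real.sqrt_nonneg _, fun p u => ?_⟩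
  have hb0 : 0 < m ^ (β / 2) := Real.rpow_pos_of_pos hm0 _
  have h1 : P.h (p + 1) ^ β ≤ C ^ β * ((((m ^ (β / 2))⁻¹) ^ p)) ^ 2 := by
    calc P.h (p + 1) ^ β ≤ (C * (m ^ p)⁻¹) ^ β :=
          Real.rpow_le_rpow (P.h_pos _).le
            ((P.h_strictAnti (Nat.lt_succ_self p)).le.trans (hh p)) hβ.le
      _ = _ := by
          rw [Real.mul_rpow hC.le (by positivity), Real.inv_rpow (by positivity),
            pow_rpow_eq_rpow_half_pow_sq hm0, inv_pow, inv_pow]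
  have h2 := hw (p + 1) (Nat.le_add_left _ _)
  rw [Nat.add_sub_cancel] at h2
  have h3 := hA.abs_normWeight_sub_one_le_supNorm p u
  refine abs_le_of_sq_le_sq' ?_ (by positivity) |> abs_le.mpr
  rw [mul_pow, Real.sq_sqrt (by positivity), ← sq_abs]
  calc |P.normWeight p u - 1| ^ 2 ≤ _ := pow_le_pow_left₀ (abs_nonneg _) h3 2
    _ ≤ K * P.h (p + 1) ^ β := h2
    _ ≤ K * (C ^ β * ((((m ^ (β / 2))⁻¹) ^ p)) ^ 2) := by gcongr
    _ = _ := by ring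

theorem evalCost_le {ζ : ℝ} (hζ : 0 < ζ) {K : ℝ} (hK : 0 < K)
    (hcost : ∀ p : ℕ, 1 ≤ p → P.evalCost (p - 1) ≤ K * P.h p ^ (-ζ)) {m c : ℝ} (hm : 1 < m)
    (hc : 0 < c) (hh : ∀ l : ℕ, c * (m ^ l)⁻¹ ≤ P.h l) (p : ℕ) :
    P.evalCost p ≤ K * c ^ (-ζ) * (m ^ (ζ / 2)) ^ 2 * ((m ^ (ζ / 2)) ^ p) ^ 2 := by
  have hm0 : 0 < m := by linarith
  have h1 := hcost (p + 1) (Nat.le_add_left _ _)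
  rw [Nat.add_sub_cancel] at h1
  have h2 : P.h (p + 1) ^ (-ζ) ≤ c ^ (-ζ) * (m ^ (ζ / 2)) ^ 2 * ((m ^ (ζ / 2)) ^ p) ^ 2 := by
    calc P.h (p + 1) ^ (-ζ) ≤ (c * (m ^ (p + 1))⁻¹) ^ (-ζ) :=
          Real.rpow_le_rpow_of_nonpos (by positivity) (hh _) (by linarith)
      _ = _ := by
          rw [Real.mul_rpow hc.le (by positivity),
            Real.rpow_neg (by positivity : 0 ≤ (m ^ (p + 1))⁻¹), Real.inv_rpow (by positivity), inv_inv, pow_rpow_eq_rpow_half_pow_sq hm0]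
          ring
  calc _ ≤ _ := h1
    _ ≤ K * (c ^ (-ζ) * (m ^ (ζ / 2)) ^ 2 * ((m ^ (ζ / 2)) ^ p) ^ 2) := by gcongr
    _ = _ := by ring

end MLSMCModel

theorem mainTheorem3 {E : Type*} [MeasurableSpace E] (P : MLSMCModel E) (α β ζ : ℝ)
    (hα : 0 < α) (hβ : 0 < β) (hζ : 0 < ζ) (hαβζ : max β ζ ≤ 2 * α)
    (hA1 : P.UniformBounds) (hA2 : P.UniformMixing)
    (hA3i : P.BiasCostRates α ζ) (hA3ii : P.WeightRate β) (hgeo : P.GeometricLevels) :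
    ∀ ε₀ : ℝ, 0 < ε₀ → ε₀ < 1 → ∃ C : ℝ, 0 < C ∧ ∀ ε : ℝ, 0 < ε → ε ≤ ε₀ →
      ∃ (L : ℕ) (N : ℕ → ℕ+), 1 ≤ L ∧ Antitone N ∧
        Integrable (fun U => (P.estimator N L U - P.γInfOne) ^ 2) (P.smcLaw N) ∧
        1 / P.γInfOne ^ 2 * ∫ U, (P.estimator N L U - P.γInfOne) ^ 2 ∂P.smcLaw N ≤ C * ε ^ 2 ∧
        P.cost N L ≤ C * costRate α β ζ ε := by
  intro ε₀ hε₀ hε₁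
  obtain ⟨m, c, Ch, hm, hc, hh⟩ := hgeo
  obtain ⟨K, hK, hrates⟩ := hA3i
  have hm0 : 0 < m := by linarith
  have hCh : 0 < Ch := by simpa using (P.h_pos 0).trans_le (hh 0).2
  set b := m ^ (β / 2) with hb
  set z := m ^ (ζ / 2) with hz
  have hb1 : 1 < b := Real.one_lt_rpow hm (by linarith)
  have hz1 : 1 < z := Real.one_lt_rpow hm (by linarith)
  obtain ⟨D, hD, hg⟩ := hA3ii.weightDecay hβ hA1 hm fun l => (hh l).2
  rw [← hb] at hg
  have ht0 : 0 ≤ b⁻¹ := by positivity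
  have ht1 : b⁻¹ < 1 := inv_lt_one_of_one_lt₀ hb1
  have hcost := MLSMCModel.evalCost_le hζ hK (fun p hp => (hrates p hp).2) hm hc fun l => (hh l).1
  obtain ⟨K₁, hK₁, h1⟩ := exists_inv_sq_le_costRate (α := α) (β := β) (ζ := ζ) hα hε₀ hε₁
  obtain ⟨K₂, hK₂, h2⟩ := exists_sum_sq_le_costRate (α := α) (β := β) (ζ := ζ) hα hm hε₀ hε₁
  obtain ⟨K₃, hK₃, h3⟩ := exists_sum_le_inv_sq hζ ((le_max_right _ _).trans hαβζ) hm
  rw [← hz] at h2 h3 hcost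
  rw [← hb] at h2
  set V := (D / (1 - b⁻¹) * Real.exp (D / (1 - b⁻¹)) ^ 2) ^ 2 with hV
  set W := (K * Ch ^ α) ^ 2 with hW
  set Q := K * c ^ (-ζ) * z ^ 2 with hQ
  have hQ0 : 0 < Q := by positivity
  have hV0 : 0 ≤ V := sq_nonneg _
  have hW0 : 0 ≤ W := sq_nonneg _
  refine ⟨2 * (2 * W + 2) * V + 2 * W + Q * (K₃ * K₁ + K₂), by positivity, fun ε hε hεε => ?_⟩
  have hε1 : ε ≤ 1 := hεε.trans hε₁.le
  -- The level is the least one at which `m^{-α L}` is below `ε`.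
  obtain ⟨n, hn, hn'⟩ := exists_nat_pow_near ((one_le_inv₀ hε).mpr hε1)
    (Real.one_lt_rpow hm hα)
  obtain ⟨N, hN, hvar, hNcost⟩ := exists_antitone_particleNumbers (b := b) (z := z)
    (by positivity) (by positivity) (one_le_mul_of_one_le_of_one_le hb1.le hz1.le) hε
    (Nat.le_add_left 1 n)
  have hbias : (P.γOne (n + 1) / P.γInfOne - 1) ^ 2 ≤ W * ε ^ 2 := by
    have hh1 : P.h (n + 1) ^ α ≤ Ch ^ α * ε := by
      calc P.h (n + 1) ^ α ≤ (Ch * (m ^ (n + 1))⁻¹) ^ α :=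
            Real.rpow_le_rpow (P.h_pos _).le (hh _).2 hα.le
        _ = Ch ^ α * ((m ^ α) ^ (n + 1))⁻¹ := by
            rw [Real.mul_rpow hCh.le (by positivity), Real.inv_rpow (by positivity),
              Real.rpow_pow_comm hm0.le]
        _ ≤ Ch ^ α * ε := by
            have := inv_le_of_inv_le₀ hε hn'.le
            gcongr
    have hr := (hrates (n + 1) (Nat.le_add_left _ _)).1
    rw [← sq_abs, hW, ← mul_pow]
    refine pow_le_pow_left₀ (abs_nonneg _) (hr.trans ?_) 2
    rw [mul_assoc]
    gcongr
  have hε2 : ε ^ 2 ≤ 1 := pow_le_one₀ hε.le hε1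
  have hr2 : (P.γOne (n + 1) / P.γInfOne) ^ 2 ≤ 2 * W + 2 := by
    have h4 : W * ε ^ 2 ≤ W := mul_le_of_le_one_right hW0 hε2
    have h5 := add_sq_le (a := P.γOne (n + 1) / P.γInfOne - 1) (b := 1)
    rw [sub_add_cancel] at h5
    linarith
  refine ⟨n + 1, N, Nat.le_add_left _ _, hN, ?_, ?_, ?_⟩
  · simp only [MLSMCModel.estimator_eq_γOne_mul]
    exact hg.integrable_estimator_sub_sq hD ht0 ht1 _ _ _
  · refine (hg.mse_le hD ht0 ht1 (Nat.le_add_left 1 n)).trans ?_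
    rw [← hV]
    have hsum0 : 0 ≤ ∑ q ∈ Finset.range (n + 1), (b⁻¹ ^ q) ^ 2 / (N q : ℝ) :=
      Finset.sum_nonneg fun _ _ => by positivity
    calc _ ≤ 2 * (2 * W + 2) * (V * ε ^ 2) + 2 * (W * ε ^ 2) := by gcongr
      _ = (2 * (2 * W + 2) * V + 2 * W + 0) * ε ^ 2 := by ring
      _ ≤ _ := by gcongr; positivity
  · have hr0 : 0 ≤ costRate α β ζ ε :=
      (pos_of_mul_pos_right ((by positivity : 0 < (ε ^ 2)⁻¹).trans_le (h1 ε hε hεε)) hK₁.le).le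
    calc P.cost N (n + 1)
        ≤ ∑ p ∈ Finset.range (n + 1), Q * ((N p : ℝ) * (z ^ p) ^ 2) := by
          refine Finset.sum_le_sum fun p _ => ?_
          calc (N p : ℝ) * P.evalCost p ≤ N p * (Q * (z ^ p) ^ 2) := by
                gcongr; exact hcost p
            _ = _ := by ring
      _ ≤ Q * (K₃ * (K₁ * costRate α β ζ ε) + K₂ * costRate α β ζ ε) := by
          rw [← Finset.mul_sum]
          have h4 := h3 ε hε hε1 n hn
          have h5 := h2 ε hε hεε n hn
          have h6 := mul_le_mul_of_nonneg_left (h1 ε hε hεε) hK₃.le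
          exact mul_le_mul_of_nonneg_left
            (hNcost.trans (add_le_add (h4.trans h6) h5)) hQ0.le
      _ = (0 + Q * (K₃ * K₁ + K₂)) * costRate α β ζ ε := by ring
      _ ≤ _ := by gcongr; positivity
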